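/- Fix a countably infinite set $\mathrm{Var}$ of variables and a variable $p_0\in\mathrm{Var}$. Formulas of the modal-multiplicative fragment are built from variables by the binary connective $\to$ and the unary connective $\Box$. Put $\overline 0:=p_0\to p_0$, $\lnot\varphi:=\varphi\to\overline 0$, $\varphi\,\&\,\psi:=\lnot\varphi\to\psi$, $0\varphi:=\overline 0$ and $(n+1)\varphi:=\varphi\,\&\,(n\varphi)$ for $n\in\mathbb N$. *Semantics.* A $\mathsf{K(A)}$-model is a triple $\langle W,R,V\rangle$ with $W\neq\emptyset$, $R\subseteq W\times W$, and $V\colon\mathrm{Var}\times W\to[-r,r]$ for some real $r\ge 0$. The map $V$ is extended to formulas by $V(\varphi\to\psi,x)=V(\psi,x)-V(\varphi,x)$ and $V(\Box\varphi,x)=\inf\{V(\varphi,y):Rxy\}$, where $\inf\emptyset:=0$ (in the full language of $\mathsf{K(A)}$ the connectives $\land,\lor,\&$ and the constant $\overline 0$ are interpreted by $\min$, $\max$, $+$, $0$). A formula $\varphi$ is $\mathsf{K(A)}$-valid if $V(\varphi,x)\ge 0$ for every $\mathsf{K(A)}$-model $\langle W,R,V\rangle$ and every $x\in W$. *Axiom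 system.* $\mathsf{K(A_m)}$ has the axiom schemata - (B) $(\varphi\to\psi)\to((\psi\to\chi)\to(\varphi\to\chi))$, - (C) $(\varphi\to(\psi\to\chi))\to(\psi\to(\varphi\to\chi))$, - (I) $\varphi\to\varphi$, - (A) $((\varphi\to\psi)\to\psi)\to\varphi$, - (K) $\Box(\varphi\to\psi)\to(\Box\varphi\to\Box\psi)$, - (D$_n$) $\Box(n\varphi)\to n\Box\varphi$ for each $n\ge 2$, and the rules (mp): from $\varphi$ and $\varphi\to\psi$ infer $\psi$; (nec): from $\varphi$ infer $\Box\varphi$; (con$_n$), for each $n\ge 2$: from $n\varphi$ infer $\varphi$. *Sequent calculus.* A sequent $\Gamma\Rightarrow\Delta$ is an ordered pair of finite multisets of formulas of the fragment. Write $\Gamma,\Delta$ for the multiset sum, $n\Gamma$ for the sum of $n$ copies of $\Gamma$, $n[\varphi]$ for the multiset consisting of $n$ copies of $\varphi$, and $\Box\Gamma$ for $[\Box\varphi:\varphi\in\Gamma]$. The rules of $\mathsf{GK(A_m)}$ are - (id): infer $\Delta\Rightarrow\Delta$ from no premises; - (cut): from $\Gamma,\varphi\Rightarrow\Delta$ and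 $\Pi\Rightarrow\varphi,\Sigma$ infer $\Gamma,\Pi\Rightarrow\Sigma,\Delta$; - (mix): from $\Gamma\Rightarrow\Delta$ and $\Pi\Rightarrow\Sigma$ infer $\Gamma,\Pi\Rightarrow\Sigma,\Delta$; - (sc$_n$), for each $n\ge 2$: from $n\Gamma\Rightarrow n\Delta$ infer $\Gamma\Rightarrow\Delta$; - ($\to\Rightarrow$): from $\Gamma,\psi\Rightarrow\varphi,\Delta$ infer $\Gamma,\varphi\to\psi\Rightarrow\Delta$; - ($\Rightarrow\to$): from $\Gamma,\varphi\Rightarrow\psi,\Delta$ infer $\Gamma\Rightarrow\varphi\to\psi,\Delta$; - ($\Box_n$), for each $n\ge 0$: from $\Gamma\Rightarrow n[\varphi]$ infer $\Box\Gamma\Rightarrow n[\Box\varphi]$. **Theorem.** For every formula $\varphi$ of the modal-multiplicative fragment, the following are equivalent: 1. $\varphi$ is $\mathsf{K(A)}$-valid; 2. $\varphi$ is derivable in the axiom system $\mathsf{K(A_m)}$; 3. the sequent $\Rightarrow\varphi$ (with empty left-hand side) is derivable in the sequent calculus $\mathsf{GK(A_m)}$. -/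

import Mathlib

universe u v

namespace ModalAbelian

/-- Formulas of the modal language of Abelian logic: variables, `∧`, `∨`, `&`, `→`, the constant
`0` and the modality `□`. -/
inductive Formula (Var : Type u) : Type u
  | var : Var → Formula Var
  | and : Formula Var → Formula Var → Formula Var
  | or : Formula Var → Formula Var → Formula Var
  | conj : Formula Var → Formula Var → Formula Var
  | imp : Formula Var → Formula Var → Formula Var
  | zero : Formula Var
  | box : Formula Var → Formula Var

/-- A `K(A)`-model: a non-empty set of worlds with a binary accessibility relation, and a valuation
of the variables at each world with values in `[-r, r]` for some fixed real `r ≥ 0`. -/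
structure KAModel (Var : Type u) where
  World : Type v
  nonempty : Nonempty World
  R : World → World → Prop
  V : Var → World → ℝ
  bounded : ∃ r : ℝ, 0 ≤ r ∧ ∀ p x, V p x ∈ Set.Icc (-r) r

/-- The value of a formula at a world. For `□` the value is the infimum over the accessible worlds,
where by convention (both in the semantics and for `sInf` on `ℝ`) the infimum of `∅` is `0`; by
`KAModel.bddBelow_value` below all infima taken here are of sets that are bounded below. -/
noncomputable def KAModel.value {Var : Type u} (M : KAModel.{u, v} Var) :
    Formula Var → M.World → ℝ
  | .var p, x => M.V p x
  | .and φ ψ, x => min (M.value φ x) (M.value ψ x)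
  | .or φ ψ, x => max (M.value φ x) (M.value ψ x)
  | .conj φ ψ, x => M.value φ x + M.value ψ x
  | .imp φ ψ, x => M.value ψ x - M.value φ x
  | .zero, _ => 0
  | .box φ, x => sInf {a : ℝ | ∃ y, M.R x y ∧ a = M.value φ y}

/-- The values of a formula over all worlds of a model are bounded. -/
theorem KAModel.exists_abs_value_le {Var : Type u} (M : KAModel.{u, v} Var) (φ : Formula Var) :
    ∃ r : ℝ, 0 ≤ r ∧ ∀ x, |M.value φ x| ≤ r := by
  induction φ with
  | var p =>
    obtain ⟨r, h0, h⟩ := M.bounded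
    exact ⟨r, h0, fun x => abs_le.2 (h p x)⟩
  | and φ ψ h1 h2 =>
    obtain ⟨r, hr, h⟩ := h1
    obtain ⟨s, hs, k⟩ := h2
    refine ⟨max r s, le_max_of_le_left hr, fun x => ?_⟩
    exact abs_min_le_max_abs_abs.trans (max_le_max (h x) (k x))
  | or φ ψ h1 h2 =>
    obtain ⟨r, hr, h⟩ := h1
    obtain ⟨s, hs, k⟩ := h2
    refine ⟨max r s, le_max_of_le_left hr, fun x => ?_⟩
    exact abs_max_le_max_abs_abs.trans (max_le_max (h x) (k x))
  | conj φ ψ h1 h2 =>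
    obtain ⟨r, hr, h⟩ := h1
    obtain ⟨s, hs, k⟩ := h2
    exact ⟨r + s, add_nonneg hr hs, fun x => (abs_add_le _ _).trans (add_le_add (h x) (k x))⟩
  | imp φ ψ h1 h2 =>
    obtain ⟨r, hr, h⟩ := h1
    obtain ⟨s, hs, k⟩ := h2
    exact ⟨s + r, add_nonneg hs hr, fun x => (abs_sub _ _).trans (add_le_add (k x) (h x))⟩
  | zero => exact ⟨0, le_rfl, fun x => by simp [KAModel.value]⟩
  | box φ h1 =>
    obtain ⟨r, hr, h⟩ := h1
    refine ⟨r, hr, fun x => ?_⟩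
    simp only [KAModel.value]
    rcases Set.eq_empty_or_nonempty {a : ℝ | ∃ y, M.R x y ∧ a = M.value φ y} with he | hne
    · rw [he, Real.sInf_empty, abs_zero]
      exact hr
    · refine abs_le.2 ⟨le_csInf hne ?_, ?_⟩
      · rintro a ⟨y, -, rfl⟩
        exact (abs_le.1 (h y)).1
      · obtain ⟨a, y, hy, rfl⟩ := hne
        have hb : BddBelow {a : ℝ | ∃ y, M.R x y ∧ a = M.value φ y} := by
          refine ⟨-r, ?_⟩
          rintro a ⟨z, -, rfl⟩
          exact (abs_le.1 (h z)).1
        exact (csInf_le hb ⟨y, hy, rfl⟩).trans (abs_le.1 (h y)).2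

/-- The set whose infimum interprets `□ φ` is bounded below. -/
theorem KAModel.bddBelow_value {Var : Type u} (M : KAModel.{u, v} Var) (φ : Formula Var)
    (x : M.World) : BddBelow {a : ℝ | ∃ y, M.R x y ∧ a = M.value φ y} := by
  obtain ⟨r, -, h⟩ := M.exists_abs_value_le φ
  refine ⟨-r, ?_⟩
  rintro a ⟨y, -, rfl⟩
  exact (abs_le.1 (h y)).1

/-- `K(A)`-validity: the formula has a value `≥ 0` at every world of every `K(A)`-model. -/
def KAValid {Var : Type u} (φ : Formula Var) : Prop :=
  ∀ (M : KAModel.{u, v} Var) (x : M.World), 0 ≤ M.value φ x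

/-- Formulas of the modal-multiplicative fragment, built from variables by `→` and `□` only. -/
inductive MFormula (Var : Type u) : Type u
  | var : Var → MFormula Var
  | imp : MFormula Var → MFormula Var → MFormula Var
  | box : MFormula Var → MFormula Var

namespace MFormula

variable {Var : Type u}

/-- The inclusion of the modal-multiplicative fragment into the full language. -/
def toFormula : MFormula Var → Formula Var
  | .var p => .var p
  | .imp φ ψ => .imp φ.toFormula ψ.toFormula
  | .box φ => .box φ.toFormula

/-- The constant `0 := p₀ → p₀`, for a fixed variable `p₀`. -/
def zero (p₀ : Var) : MFormula Var := imp (var p₀) (var p₀)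

/-- `¬ φ := φ → 0`. -/
def neg (p₀ : Var) (φ : MFormula Var) : MFormula Var := imp φ (zero p₀)

/-- `φ & ψ := ¬ φ → ψ`. -/
def conj (p₀ : Var) (φ ψ : MFormula Var) : MFormula Var := imp (neg p₀ φ) ψ

/-- `0 φ := 0` and `(n + 1) φ := φ & (n φ)`. -/
def mult (p₀ : Var) : ℕ → MFormula Var → MFormula Var
  | 0, _ => zero p₀
  | n + 1, φ => conj p₀ φ (mult p₀ n φ)

end MFormula

open MFormula in
/-- Derivability in the Hilbert system `K(A_m)`. -/
inductive HilbertDerivable {Var : Type u} (p₀ : Var) : MFormula Var → Prop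
  | axB (φ ψ χ : MFormula Var) :
      HilbertDerivable p₀ (imp (imp φ ψ) (imp (imp ψ χ) (imp φ χ)))
  | axC (φ ψ χ : MFormula Var) :
      HilbertDerivable p₀ (imp (imp φ (imp ψ χ)) (imp ψ (imp φ χ)))
  | axI (φ : MFormula Var) : HilbertDerivable p₀ (imp φ φ)
  | axA (φ ψ : MFormula Var) : HilbertDerivable p₀ (imp (imp (imp φ ψ) ψ) φ)
  | axK (φ ψ : MFormula Var) :
      HilbertDerivable p₀ (imp (box (imp φ ψ)) (imp (box φ) (box ψ)))
  | axD (n : ℕ) (hn : 2 ≤ n) (φ : MFormula Var) :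
      HilbertDerivable p₀ (imp (box (mult p₀ n φ)) (mult p₀ n (box φ)))
  | mp (φ ψ : MFormula Var) :
      HilbertDerivable p₀ φ → HilbertDerivable p₀ (imp φ ψ) → HilbertDerivable p₀ ψ
  | nec (φ : MFormula Var) : HilbertDerivable p₀ φ → HilbertDerivable p₀ (box φ)
  | con (n : ℕ) (hn : 2 ≤ n) (φ : MFormula Var) :
      HilbertDerivable p₀ (mult p₀ n φ) → HilbertDerivable p₀ φ

open MFormula in
/-- `SequentDerivable Γ Δ` means that the sequent `Γ ⇒ Δ` (a pair of finite multisets of formulas)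
is derivable in the sequent calculus `GK(A_m)`. -/
inductive SequentDerivable {Var : Type u} :
    Multiset (MFormula Var) → Multiset (MFormula Var) → Prop
  | id (Δ : Multiset (MFormula Var)) : SequentDerivable Δ Δ
  | cut (Γ Δ Θ Ξ : Multiset (MFormula Var)) (φ : MFormula Var) :
      SequentDerivable (Γ + {φ}) Δ → SequentDerivable Θ ({φ} + Ξ) →
        SequentDerivable (Γ + Θ) (Ξ + Δ)
  | mix (Γ Δ Θ Ξ : Multiset (MFormula Var)) :
      SequentDerivable Γ Δ → SequentDerivable Θ Ξ → SequentDerivable (Γ + Θ) (Ξ + Δ)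
  | sc (n : ℕ) (hn : 2 ≤ n) (Γ Δ : Multiset (MFormula Var)) :
      SequentDerivable (n • Γ) (n • Δ) → SequentDerivable Γ Δ
  | impLeft (Γ Δ : Multiset (MFormula Var)) (φ ψ : MFormula Var) :
      SequentDerivable (Γ + {ψ}) ({φ} + Δ) → SequentDerivable (Γ + {imp φ ψ}) Δ
  | impRight (Γ Δ : Multiset (MFormula Var)) (φ ψ : MFormula Var) :
      SequentDerivable (Γ + {φ}) ({ψ} + Δ) → SequentDerivable Γ ({imp φ ψ} + Δ)
  | boxRule (n : ℕ) (Γ : Multiset (MFormula Var)) (φ : MFormula Var) :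
      SequentDerivable Γ (n • {φ}) → SequentDerivable (Γ.map box) (n • {box φ})

end ModalAbelian

/-!
Formulas are interpreted in abelian groups, `φ → ψ` being the difference `ψ - φ`. The three
conditions are connected in a cycle.

*Valid formulas are theorems of the Hilbert system* (`HilbertDerivable.of_valid`). The Lindenbaum
algebra `Lindenbaum p₀` is an ordered abelian group in which `n a ≥ 0` implies `a ≥ 0` for
`n ≥ 1`, and in which `□` is monotone, superadditive and commutes with natural multiples. A
countermodel for `φ` is sought on a finite tree whose nodes carry additive maps from this group to
`ℚ`: along each edge the map at the child must dominate the values of `□` at the parent, and each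
`□ θ` that occurs in `φ` has a child at which the map attains its value at `θ`. These are finitely
many linear constraints, so by Farkas' lemma
(`exists_nsmul_eq_sum_of_forall_nonneg`) either they can be met with `φ` negative at the root, or
a positive multiple of `φ` at the root is a natural combination of the constraints. In the second
case the tree is folded up from the leaves (`nonneg_or_exists_tree`): the relation at a node reads
`∑ cᵢ χᵢ ≤ n θ`, which yields `∑ cᵢ □ χᵢ ≤ n □ θ` at its parent, and finally `0 ≤ φ` at the root.
In the first case the maps at the nodes define a bounded model in which `φ` takes its negative
value at the root (`treeModel_value_eq`).

*Theorems of the Hilbert system are derivable as sequents*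
(`SequentDerivable.of_hilbertDerivable`). The axioms are derived one by one; `n φ` may be exchanged
for `n` copies of `φ` on either side of a sequent.

*Derivable sequents are valid* (`SequentDerivable.sum_value_le`): at each world the sum of the
values on the left is at most the sum of the values on the right.
-/

namespace ModalAbelian

open MFormula

/-! ### The Lindenbaum group of the Hilbert system -/

section Hilbert

variable {Var : Type u} {p₀ : Var}

namespace HilbertDerivable

theorem imp_trans {φ ψ χ : MFormula Var} (h₁ : HilbertDerivable p₀ (imp φ ψ))
    (h₂ : HilbertDerivable p₀ (imp ψ χ)) : HilbertDerivable p₀ (imp φ χ) :=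
  mp _ _ h₂ (mp _ _ h₁ (axB _ _ _))

theorem imp_swap {φ ψ χ : MFormula Var} (h : HilbertDerivable p₀ (imp φ (imp ψ χ))) :
    HilbertDerivable p₀ (imp ψ (imp φ χ)) :=
  mp _ _ h (axC _ _ _)

theorem imp_mono {φ φ' ψ ψ' : MFormula Var} (h₁ : HilbertDerivable p₀ (imp φ' φ))
    (h₂ : HilbertDerivable p₀ (imp ψ ψ')) :
    HilbertDerivable p₀ (imp (imp φ ψ) (imp φ' ψ')) :=
  imp_trans (mp _ _ h₁ (axB _ _ _)) (mp _ _ h₂ (imp_swap (axB _ _ _)))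

/-- Every instance of `φ → φ` implies every theorem: from `⊢ θ` one has `⊢ (θ → φ) → φ`, hence
`φ → φ` implies `(θ → φ) → φ`, which implies `θ` by the axiom (A). -/
theorem imp_self_imp {θ : MFormula Var} (φ : MFormula Var) (h : HilbertDerivable p₀ θ) :
    HilbertDerivable p₀ (imp (imp φ φ) θ) :=
  imp_trans (imp_mono (mp _ _ h (imp_swap (axI _))) (axI _)) (axA θ φ)

theorem box_mono {φ ψ : MFormula Var} (h : HilbertDerivable p₀ (imp φ ψ)) :
    HilbertDerivable p₀ (imp (box φ) (box ψ)) :=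
  mp _ _ (nec _ h) (axK _ _)

end HilbertDerivable

/-- Provable equivalence in the Hilbert system. -/
def provEquiv (p₀ : Var) : Setoid (MFormula Var) where
  r φ ψ := HilbertDerivable p₀ (imp φ ψ) ∧ HilbertDerivable p₀ (imp ψ φ)
  iseqv :=
    { refl := fun _ => ⟨.axI _, .axI _⟩
      symm := fun h => ⟨h.2, h.1⟩
      trans := fun h k => ⟨h.1.imp_trans k.1, k.2.imp_trans h.2⟩ }

/-- The Lindenbaum algebra of the Hilbert system: formulas modulo provable equivalence. It is an
ordered abelian group in which the class of `φ → ψ` is the difference of the classes of `ψ` and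
`φ`, and the theorems are the formulas with a non-negative class. -/
def Lindenbaum (p₀ : Var) : Type u := Quotient (provEquiv p₀)

namespace Lindenbaum

/-- The class of a formula. -/
def mk (p₀ : Var) (φ : MFormula Var) : Lindenbaum p₀ := Quotient.mk (provEquiv p₀) φ

theorem mk_surjective (a : Lindenbaum p₀) : ∃ φ, mk p₀ φ = a := Quotient.exists_rep a

/-- The operation induced by implication. -/
def impl : Lindenbaum p₀ → Lindenbaum p₀ → Lindenbaum p₀ :=
  Quotient.map₂ imp fun _ _ h _ _ k => ⟨.imp_mono h.2 k.1, .imp_mono h.1 k.2⟩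

/-- The operation induced by the modality. -/
def nec : Lindenbaum p₀ → Lindenbaum p₀ :=
  Quotient.map box fun _ _ h => ⟨.box_mono h.1, .box_mono h.2⟩

theorem mk_imp (φ ψ : MFormula Var) : mk p₀ (imp φ ψ) = impl (mk p₀ φ) (mk p₀ ψ) := rfl

theorem mk_box (φ : MFormula Var) : mk p₀ (box φ) = nec (mk p₀ φ) := rfl

instance : PartialOrder (Lindenbaum p₀) where
  le := Quotient.lift₂ (fun φ ψ => HilbertDerivable p₀ (imp φ ψ)) fun _ _ _ _ h k =>
    propext ⟨fun l => (h.2.imp_trans l).imp_trans k.1, fun l => (h.1.imp_trans l).imp_trans k.2⟩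
  le_refl := by
    rintro ⟨φ⟩
    exact .axI φ
  le_trans := by
    rintro ⟨φ⟩ ⟨ψ⟩ ⟨χ⟩ h k
    exact HilbertDerivable.imp_trans h k
  le_antisymm := by
    rintro ⟨φ⟩ ⟨ψ⟩ h k
    exact Quotient.sound ⟨h, k⟩

theorem mk_le_mk {φ ψ : MFormula Var} :
    mk p₀ φ ≤ mk p₀ ψ ↔ HilbertDerivable p₀ (imp φ ψ) := Iff.rfl

instance : Zero (Lindenbaum p₀) := ⟨mk p₀ (zero p₀)⟩

theorem zero_le_mk {φ : MFormula Var} : 0 ≤ mk p₀ φ ↔ HilbertDerivable p₀ φ :=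
  ⟨fun h => .mp _ _ (.axI _) (mk_le_mk.1 h), fun h => mk_le_mk.2 (.imp_self_imp _ h)⟩

theorem impl_left_comm (a b c : Lindenbaum p₀) : impl a (impl b c) = impl b (impl a c) := by
  obtain ⟨φ, rfl⟩ := mk_surjective a
  obtain ⟨ψ, rfl⟩ := mk_surjective b
  obtain ⟨χ, rfl⟩ := mk_surjective c
  exact le_antisymm (mk_le_mk.2 (.axC _ _ _)) (mk_le_mk.2 (.axC _ _ _))

theorem impl_impl (a b : Lindenbaum p₀) : impl (impl a b) b = a := by
  obtain ⟨φ, rfl⟩ := mk_surjective a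
  obtain ⟨ψ, rfl⟩ := mk_surjective b
  exact le_antisymm (mk_le_mk.2 (.axA _ _)) (mk_le_mk.2 (.imp_swap (.axI _)))

theorem impl_self (a : Lindenbaum p₀) : impl a a = 0 := by
  obtain ⟨φ, rfl⟩ := mk_surjective a
  exact le_antisymm (mk_le_mk.2 (.imp_self_imp _ (.axI _))) (zero_le_mk.2 (.axI _))

theorem zero_impl (a : Lindenbaum p₀) : impl 0 a = a := by
  rw [← impl_self a, impl_impl]

instance : Neg (Lindenbaum p₀) := ⟨fun a => impl a 0⟩

instance : Add (Lindenbaum p₀) := ⟨fun a b => impl (-a) b⟩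

theorem neg_def (a : Lindenbaum p₀) : -a = impl a 0 := rfl

theorem add_def (a b : Lindenbaum p₀) : a + b = impl (impl a 0) b := rfl

theorem add_comm' (a b : Lindenbaum p₀) : a + b = b + a := by
  calc a + b = impl (impl a 0) (impl (impl b 0) 0) := by rw [impl_impl, add_def]
    _ = b + a := by rw [impl_left_comm, impl_impl, add_def]

instance : AddCommGroup (Lindenbaum p₀) where
  add_assoc a b c := by
    rw [add_comm' (a + b) c, add_comm' b c]
    exact impl_left_comm _ _ _
  zero_add a := by rw [add_def, impl_self, zero_impl]
  add_zero a := by rw [add_comm', add_def, impl_self, zero_impl]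
  neg_add_cancel a := by rw [add_def, neg_def, impl_impl, impl_self]
  add_comm := add_comm'
  nsmul := nsmulRec
  zsmul := zsmulRec

theorem impl_eq_sub (a b : Lindenbaum p₀) : impl a b = b - a := by
  rw [sub_eq_add_neg, add_comm, add_def, neg_def, impl_impl]

theorem mk_imp_eq_sub (φ ψ : MFormula Var) : mk p₀ (imp φ ψ) = mk p₀ ψ - mk p₀ φ := by
  rw [mk_imp, impl_eq_sub]

theorem le_iff_sub_nonneg (a b : Lindenbaum p₀) : a ≤ b ↔ 0 ≤ b - a := by
  obtain ⟨φ, rfl⟩ := mk_surjective a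
  obtain ⟨ψ, rfl⟩ := mk_surjective b
  rw [← mk_imp_eq_sub, zero_le_mk, mk_le_mk]

instance : IsOrderedAddMonoid (Lindenbaum p₀) where
  add_le_add_left a b h c := by
    rw [le_iff_sub_nonneg] at h ⊢
    simpa using h

theorem mk_mult (n : ℕ) (φ : MFormula Var) : mk p₀ (mult p₀ n φ) = n • mk p₀ φ := by
  induction n with
  | zero => rw [zero_smul]; rfl
  | succ n ih =>
    rw [succ_nsmul', ← ih]
    rfl

theorem nonneg_of_nsmul_nonneg {n : ℕ} (hn : n ≠ 0) {a : Lindenbaum p₀} (h : 0 ≤ n • a) :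
    0 ≤ a := by
  obtain ⟨φ, rfl⟩ := mk_surjective a
  obtain rfl | hn : n = 1 ∨ 2 ≤ n := by omega
  · simpa using h
  · rw [← mk_mult, zero_le_mk] at h
    exact zero_le_mk.2 (.con n hn φ h)

theorem nec_mono : Monotone (nec : Lindenbaum p₀ → Lindenbaum p₀) := by
  intro a b h
  obtain ⟨φ, rfl⟩ := mk_surjective a
  obtain ⟨ψ, rfl⟩ := mk_surjective b
  exact mk_le_mk.2 (.box_mono h)

theorem nec_sub_le (a b : Lindenbaum p₀) : nec (b - a) ≤ nec b - nec a := by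
  obtain ⟨φ, rfl⟩ := mk_surjective a
  obtain ⟨ψ, rfl⟩ := mk_surjective b
  rw [← mk_imp_eq_sub, ← mk_box, ← mk_box, ← mk_box, ← mk_imp_eq_sub]
  exact mk_le_mk.2 (.axK _ _)

theorem nec_add_le (a b : Lindenbaum p₀) : nec a + nec b ≤ nec (a + b) := by
  simpa [le_sub_iff_add_le] using nec_sub_le b (a + b)

theorem nec_zero : nec (0 : Lindenbaum p₀) = 0 := by
  refine le_antisymm (by simpa using nec_add_le (0 : Lindenbaum p₀) 0) ?_
  exact zero_le_mk.2 (.nec _ (.axI _))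

theorem nsmul_nec_le (n : ℕ) (a : Lindenbaum p₀) : n • nec a ≤ nec (n • a) := by
  induction n with
  | zero => simp [nec_zero]
  | succ n ih =>
    rw [succ_nsmul, succ_nsmul]
    exact (add_le_add_left ih _).trans (nec_add_le _ _)

theorem nec_nsmul (n : ℕ) (a : Lindenbaum p₀) : nec (n • a) = n • nec a := by
  refine le_antisymm ?_ (nsmul_nec_le n a)
  obtain rfl | rfl | hn : n = 0 ∨ n = 1 ∨ 2 ≤ n := by omega
  · simp [nec_zero]
  · simp
  · obtain ⟨φ, rfl⟩ := mk_surjective a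
    rw [← mk_mult, ← mk_box, ← mk_box, ← mk_mult]
    exact mk_le_mk.2 (.axD n hn φ)

theorem sum_nec_le {ι : Type*} (s : Finset ι) (f : ι → Lindenbaum p₀) :
    ∑ i ∈ s, nec (f i) ≤ nec (∑ i ∈ s, f i) := by
  classical
  induction s using Finset.induction_on with
  | empty => simp [nec_zero]
  | insert i s hi ih =>
    rw [Finset.sum_insert hi, Finset.sum_insert hi]
    exact (add_le_add_right ih _).trans (nec_add_le _ _)

/-- The algebraic form of the rules for `□`: an inequality `∑ cᵢ fᵢ ≤ n a` between classes may be
prefixed with `□` termwise. -/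
theorem sum_nsmul_nec_le {ι : Type*} (s : Finset ι) (c : ι → ℕ) (f : ι → Lindenbaum p₀)
    {n : ℕ} {a : Lindenbaum p₀} (h : ∑ i ∈ s, c i • f i ≤ n • a) :
    ∑ i ∈ s, c i • nec (f i) ≤ n • nec a := by
  rw [← nec_nsmul]
  simp only [← nec_nsmul]
  exact (sum_nec_le s _).trans (nec_mono h)

end Lindenbaum

end Hilbert

/-! ### Farkas' lemma with integer certificates -/

theorem exists_nat_mul_eq {u v : ℚ} (hu : 0 ≤ u) (hv : 0 < v) :
    ∃ p q : ℕ, 0 < p ∧ (p : ℚ) * u = q * v := by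
  refine ⟨(u / v).den, (u / v).num.toNat, (u / v).pos, ?_⟩
  have h0 : 0 ≤ (u / v).num := Rat.num_nonneg.2 (div_nonneg hu hv.le)
  have h1 : (((u / v).num.toNat : ℕ) : ℚ) = ((u / v).num : ℚ) := by
    exact_mod_cast Int.toNat_of_nonneg h0
  have h2 : (u / v) * (u / v).den = (u / v).num := Rat.mul_den_eq_num _
  rw [h1, ← h2]
  field_simp

/-- An element of an abelian group on which all rational characters are non-negative is torsion:
otherwise the character of `ℤ b` with value `-1` at `b` extends, as `ℚ` is divisible. -/
theorem exists_nsmul_eq_zero_of_forall_nonneg {E : Type*} [AddCommGroup E] (b : E)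
    (h : ∀ x : E →+ ℚ, 0 ≤ x b) : ∃ n : ℕ, 0 < n ∧ n • b = 0 := by
  by_contra! hb
  have hinj : Function.Injective (zmultiplesHom E b) := by
    rw [injective_iff_map_eq_zero]
    intro m hm
    by_contra hm0
    refine hb m.natAbs (Int.natAbs_pos.2 hm0) ?_
    rw [zmultiplesHom_apply] at hm
    rw [← natCast_zsmul, Int.natCast_natAbs]
    rcases abs_choice m with h' | h' <;> simp [h', hm]
  obtain ⟨x, hx⟩ := (Module.Baer.of_divisible ℚ).extension_property_addMonoidHom
    (zmultiplesHom E b) hinj (-(Int.castAddHom ℚ))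
  have h1 := DFunLike.congr_fun hx 1
  have h2 := h x
  simp at h1
  rw [h1] at h2
  norm_num at h2

/-- Farkas' lemma in an abelian group: if every homomorphism to `ℚ` that is non-negative on the
finite family `a` is non-negative at `b`, then a positive multiple of `b` is a combination of the
family with natural coefficients.

The proof is by induction on the family. If the member `a j` is needed, some `x₀` is non-negative
on the other members and negative at `b` and `a j`; the other members and `b` are then
replaced by positive multiples of their projections along `a j` to the kernel of `x₀`. -/
theorem exists_nsmul_eq_sum_of_forall_nonneg {E ι : Type*} [AddCommGroup E] (s : Finset ι)
    (a : ι → E) (b : E) (h : ∀ x : E →+ ℚ, (∀ i ∈ s, 0 ≤ x (a i)) → 0 ≤ x b) :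
    ∃ n : ℕ, 0 < n ∧ ∃ c : ι → ℕ, n • b = ∑ i ∈ s, c i • a i := by
  classical
  induction s using Finset.induction_on generalizing a b with
  | empty =>
    obtain ⟨n, hn, hb⟩ := exists_nsmul_eq_zero_of_forall_nonneg b fun x => h x (by simp)
    exact ⟨n, hn, 0, by simpa using hb⟩
  | insert j s hj ih =>
    by_cases hs : ∀ x : E →+ ℚ, (∀ i ∈ s, 0 ≤ x (a i)) → 0 ≤ x b
    · obtain ⟨n, hn, c, hc⟩ := ih a b hs
      refine ⟨n, hn, Function.update c j 0, ?_⟩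
      rw [Finset.sum_insert hj, hc]
      simp only [Function.update_self, zero_smul, zero_add]
      refine Finset.sum_congr rfl fun i hi => ?_
      rw [Function.update_of_ne (ne_of_mem_of_not_mem hi hj)]
    push Not at hs
    obtain ⟨x₀, hx₀, hb₀⟩ := hs
    have hj₀ : x₀ (a j) < 0 := by
      by_contra! hj₀
      refine absurd (h x₀ ?_) (not_le.2 hb₀)
      simpa [hj₀] using hx₀
    have key : ∀ i, ∃ p q : ℕ, 0 < p ∧ (i ∈ s → (p : ℚ) * x₀ (a i) + q * x₀ (a j) = 0) := by
      intro i
      by_cases hi : i ∈ s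
      · obtain ⟨p, q, hp, hpq⟩ := exists_nat_mul_eq (hx₀ i hi) (neg_pos.2 hj₀)
        exact ⟨p, q, hp, fun _ => by linarith⟩
      · exact ⟨1, 0, one_pos, fun hi' => absurd hi' hi⟩
    choose p q hp hpq using key
    obtain ⟨m, l, hm, hml⟩ := exists_nat_mul_eq (neg_pos.2 hb₀).le (neg_pos.2 hj₀)
    obtain ⟨n, hn, c, hc⟩ := ih (fun i => p i • a i + q i • a j) (m • b - l • a j) (by
      intro x hx
      -- `y` agrees with `x` on the kernel of `x₀` up to a multiple of `x₀` and kills `a j`.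
      obtain ⟨y, hy⟩ : ∃ y : E →+ ℚ, ∀ e, y e = x e - x (a j) / x₀ (a j) * x₀ e :=
        ⟨x - (AddMonoidHom.mulLeft (x (a j) / x₀ (a j))).comp x₀, fun e => rfl⟩
      have hyj : y (a j) = 0 := by
        rw [hy, div_mul_cancel₀ _ hj₀.ne, sub_self]
      have hyb : 0 ≤ y b := by
        refine h y fun i hi => ?_
        rcases Finset.mem_insert.1 hi with rfl | hi
        · rw [hyj]
        · have h1 := hx i hi
          have h2 := hy (p i • a i + q i • a j)
          simp only [map_add, map_nsmul, hyj, nsmul_eq_mul, hpq i hi, mul_zero, add_zero,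
            sub_zero] at h1 h2
          rw [← h2] at h1
          exact nonneg_of_mul_nonneg_right h1 (by exact_mod_cast hp i)
      have h2 := hy (m • b - l • a j)
      simp only [map_sub, map_nsmul, hyj, nsmul_eq_mul, mul_zero, sub_zero] at h2 ⊢
      have h3 : (m : ℚ) * x₀ b - l * x₀ (a j) = 0 := by linarith
      rw [h3, mul_zero, sub_zero] at h2
      rw [← h2]
      positivity)
    refine ⟨n * m, Nat.mul_pos hn hm,
      fun i => if i = j then n * l + ∑ k ∈ s, c k * q k else c i * p i, ?_⟩
    rw [Finset.sum_insert hj]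
    have h1 : ∑ i ∈ s, (if i = j then n * l + ∑ k ∈ s, c k * q k else c i * p i) • a i =
        ∑ i ∈ s, (c i * p i) • a i :=
      Finset.sum_congr rfl fun i hi => by rw [if_neg (ne_of_mem_of_not_mem hi hj)]
    simp only [h1, ↓reduceIte]
    have h2 : ∑ i ∈ s, c i • (p i • a i + q i • a j) =
        ∑ i ∈ s, (c i * p i) • a i + (∑ k ∈ s, c k * q k) • a j := by
      simp only [smul_add, Finset.sum_add_distrib, Finset.sum_smul, mul_smul]
    rw [h2, smul_sub, sub_eq_iff_eq_add] at hc
    rw [mul_smul, hc, add_smul, mul_smul]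
    abel

/-! ### Countermodels on finite trees -/

section Completeness

variable {Var : Type u} {p₀ : Var}

open Lindenbaum

/-- The characters needed for a tree countermodel. The nodes are lists, the root is `[]` and the
children of `t` are the lists `i :: t`. At each node `t` of length less than `d`, the character at
the child `i :: t` dominates the values of `□` at `t` and attains the value of `□ (g i)`.

If no such characters are negative at `b`, Farkas' lemma in the group of maps from nodes to the
Lindenbaum group writes a multiple of `b`, placed at the root, as a natural combination of these
constraints. Prefixing the relation at a node with `□` shows that the total contribution of that
node's constraints to its parent is non-negative; at the root this gives `0 ≤ b`. -/
theorem nonneg_or_exists_tree {k : ℕ} (g : Fin k → Lindenbaum p₀) (d : ℕ) (b : Lindenbaum p₀) :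
    0 ≤ b ∨ ∃ h : List (Fin k) → Lindenbaum p₀ →+ ℚ, h [] b < 0 ∧
      ∀ t, t.length < d → ∀ i, (∀ j, h t (nec (g j)) ≤ h (i :: t) (g j)) ∧
        h (i :: t) (g i) = h t (nec (g i)) := by
  classical
  by_cases hx : ∃ h : List (Fin k) → Lindenbaum p₀ →+ ℚ, h [] b < 0 ∧
      ∀ t, t.length < d → ∀ i, (∀ j, h t (nec (g j)) ≤ h (i :: t) (g j)) ∧
        h (i :: t) (g i) = h t (nec (g i))
  · exact Or.inr hx
  left
  let s : Finset (List (Fin k)) := (List.finite_length_lt (Fin k) d).toFinset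
  have hs : ∀ t, t ∈ s ↔ t.length < d := fun t => by simp [s]
  let e : List (Fin k) → Lindenbaum p₀ →+ (List (Fin k) → Lindenbaum p₀) :=
    AddMonoidHom.single (fun _ => Lindenbaum p₀)
  let a : List (Fin k) × Fin k × Option (Fin k) → List (Fin k) → Lindenbaum p₀ := fun z =>
    match z with
    | (t, i, some j) => e (i :: t) (g j) - e t (nec (g j))
    | (t, i, none) => e t (nec (g i)) - e (i :: t) (g i)
  obtain ⟨n, hn, c, hc⟩ := exists_nsmul_eq_sum_of_forall_nonneg
    (s ×ˢ (Finset.univ : Finset (Fin k × Option (Fin k)))) a (e [] b) (by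
      intro x hxa
      by_contra! hb
      refine hx ⟨fun t => x.comp (e t), hb, fun t ht i => ?_⟩
      have h1 : ∀ j, x (e t (nec (g j))) ≤ x (e (i :: t) (g j)) := fun j => by
        have := hxa (t, i, some j) (by simp [hs, ht])
        simpa [a] using this
      have h2 : x (e (i :: t) (g i)) ≤ x (e t (nec (g i))) := by
        have := hxa (t, i, none) (by simp [hs, ht])
        simpa [a] using this
      exact ⟨h1, le_antisymm h2 (h1 i)⟩)
  -- The constraints along the edge from `t` to `i :: t` add up to `D t i` at `t` and `F t i` at
  -- `i :: t`.
  let D : List (Fin k) → Fin k → Lindenbaum p₀ := fun t i =>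
    c (t, i, none) • nec (g i) - ∑ j, c (t, i, some j) • nec (g j)
  let F : List (Fin k) → Fin k → Lindenbaum p₀ := fun t i =>
    (∑ j, c (t, i, some j) • g j) - c (t, i, none) • g i
  have hsum : n • e [] b = ∑ t ∈ s, ∑ i, (e t (D t i) + e (i :: t) (F t i)) := by
    rw [hc, Finset.sum_product]
    refine Finset.sum_congr rfl fun t _ => ?_
    rw [Fintype.sum_prod_type]
    refine Finset.sum_congr rfl fun i _ => ?_
    rw [Fintype.sum_option]
    simp only [a, D, F, map_sub, map_sum, map_nsmul, smul_sub, Finset.sum_sub_distrib]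
    abel
  have happ : ∀ t u w, e t w u = if u = t then w else 0 := fun t u w => by
    simp [e, Pi.single_apply]
  have hnode : ∀ t i, t ∈ s → (if i :: t ∈ s then ∑ j, D (i :: t) j else 0) + F t i = 0 := by
    intro t i ht
    have := congrFun hsum (i :: t)
    simp only [Pi.smul_apply, Finset.sum_apply, Pi.add_apply, happ, Finset.sum_add_distrib,
      List.cons.injEq, ite_and, reduceCtorEq, ↓reduceIte, smul_zero] at this
    refine Eq.trans ?_ this.symm
    congr 1
    · rw [← Finset.sum_ite_eq s (i :: t) fun u => ∑ j, D u j]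
      refine Finset.sum_congr rfl fun u _ => ?_
      split_ifs <;> simp
    · simp [ht]
  have hroot : n • b = if [] ∈ s then ∑ j, D [] j else 0 := by
    have := congrFun hsum []
    simp only [Pi.smul_apply, Finset.sum_apply, Pi.add_apply, happ, Finset.sum_add_distrib,
      reduceCtorEq, ↓reduceIte, Finset.sum_const_zero, add_zero] at this
    rw [this, ← Finset.sum_ite_eq s [] fun u => ∑ j, D u j]
    refine Finset.sum_congr rfl fun u _ => ?_
    split_ifs <;> simp
  have hD : ∀ m, ∀ t ∈ s, d - t.length ≤ m → ∀ i, 0 ≤ D t i := by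
    intro m
    induction m with
    | zero =>
      intro t ht hm
      have := (hs t).1 ht
      omega
    | succ m ih =>
      intro t ht hm i
      refine sub_nonneg.2 (sum_nsmul_nec_le _ _ _ ?_)
      rw [← sub_nonpos]
      change F t i ≤ 0
      rw [← neg_nonneg, ← eq_neg_of_add_eq_zero_left (hnode t i ht)]
      split_ifs with hit
      · refine Finset.sum_nonneg fun j _ => ih _ hit ?_ j
        simp only [List.length_cons]
        omega
      · exact le_rfl
  refine nonneg_of_nsmul_nonneg hn.ne' ?_
  rw [hroot]
  split_ifs with h0
  · exact Finset.sum_nonneg fun j _ => hD _ _ h0 le_rfl j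
  · exact le_rfl

/-- The formulas that occur in a given one immediately below a `□`. -/
def boxBodies : MFormula Var → Set (MFormula Var)
  | .var _ => ∅
  | .imp φ ψ => boxBodies φ ∪ boxBodies ψ
  | .box φ => insert φ (boxBodies φ)

/-- The variables that occur in a formula. -/
def vars : MFormula Var → Set Var
  | .var p => {p}
  | .imp φ ψ => vars φ ∪ vars ψ
  | .box φ => vars φ

/-- The modal depth of a formula. -/
def depth : MFormula Var → ℕ
  | .var _ => 0
  | .imp φ ψ => max (depth φ) (depth ψ)
  | .box φ => depth φ + 1

theorem finite_boxBodies (φ : MFormula Var) : (boxBodies φ).Finite := by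
  induction φ with
  | var p => exact Set.finite_empty
  | imp φ ψ h k => exact h.union k
  | box φ h => exact h.insert φ

theorem finite_vars (φ : MFormula Var) : (vars φ).Finite := by
  induction φ with
  | var p => exact Set.finite_singleton p
  | imp φ ψ h k => exact h.union k
  | box φ h => exact h

/-- The tree model with nodes `List (Fin k)`, in which the children of `t` are the lists `i :: t`,
for given values of the variables. The values are truncated to `[-r, r]` so that the model is
bounded; the index set is `Fin k` so that the model exists in every universe. -/
def treeModel (k : ℕ) (r : ℝ) (hr : 0 ≤ r) (f : Var → List (Fin k) → ℝ) : KAModel.{u, v} Var where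
  World := ULift.{v} (List (Fin k))
  nonempty := ⟨⟨[]⟩⟩
  R t w := ∃ i, w.down = i :: t.down
  V p t := max (-r) (min r (f p t.down))
  bounded := ⟨r, hr, fun p t => ⟨le_max_left _ _, max_le (by linarith) (min_le_left _ _)⟩⟩

/-- In the tree model whose variables take the values of the characters `h t`, so do all formulas of
depth at most the remaining height: the child `i :: t` attains the infimum for `□ (β i)` at `t`. -/
theorem treeModel_value_eq {k : ℕ} {r : ℝ} (hr : 0 ≤ r) (β : Fin k → MFormula Var)
    (h : List (Fin k) → Lindenbaum p₀ →+ ℚ) (U : Set Var) (d : ℕ)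
    (hU : ∀ p ∈ U, ∀ t : List (Fin k), t.length ≤ d → |(h t (mk p₀ (.var p)) : ℝ)| ≤ r)
    (hh : ∀ t, t.length < d → ∀ i, (∀ j, h t (nec (mk p₀ (β j))) ≤ h (i :: t) (mk p₀ (β j))) ∧
        h (i :: t) (mk p₀ (β i)) = h t (nec (mk p₀ (β i))))
    (ψ : MFormula Var) (hv : vars ψ ⊆ U) (hb : boxBodies ψ ⊆ Set.range β)
    (t : List (Fin k)) (ht : depth ψ + t.length ≤ d) :
    (treeModel.{u, v} k r hr fun p t => (h t (mk p₀ (.var p)) : ℝ)).value ψ.toFormula ⟨t⟩ =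
      (h t (mk p₀ ψ) : ℝ) := by
  induction ψ generalizing t with
  | var p =>
    have h1 := abs_le.1 (hU p (hv rfl) t (by omega))
    change max (-r) (min r _) = _
    rw [min_eq_right h1.2, max_eq_right h1.1]
  | imp φ ψ ihφ ihψ =>
    have hd : max (depth φ) (depth ψ) + t.length ≤ d := ht
    have h1 := ihφ (Set.subset_union_left.trans hv) (Set.subset_union_left.trans hb) t
      (by have := le_max_left (depth φ) (depth ψ); omega)
    have h2 := ihψ (Set.subset_union_right.trans hv) (Set.subset_union_right.trans hb) t
      (by have := le_max_right (depth φ) (depth ψ); omega)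
    simp only [toFormula, KAModel.value]
    rw [h1, h2, mk_imp_eq_sub, map_sub, Rat.cast_sub]
  | box φ ih =>
    have hd : depth φ + 1 + t.length ≤ d := ht
    obtain ⟨i, rfl⟩ := hb (Set.mem_insert _ _)
    have h1 : ∀ j, (treeModel.{u, v} k r hr fun p t => (h t (mk p₀ (.var p)) : ℝ)).value
        (β i).toFormula ⟨j :: t⟩ = (h (j :: t) (mk p₀ (β i)) : ℝ) := fun j =>
      ih hv ((Set.subset_insert _ _).trans hb) (j :: t) (by simp only [List.length_cons]; omega)
    have hlt : t.length < d := by omega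
    simp only [toFormula, KAModel.value]
    refine IsLeast.csInf_eq ⟨⟨⟨i :: t⟩, ⟨i, rfl⟩, ?_⟩, ?_⟩
    · rw [h1, mk_box, (hh t hlt i).2]
    · rintro _ ⟨⟨w⟩, ⟨j, rfl : w = j :: t⟩, rfl⟩
      rw [h1, mk_box]
      exact_mod_cast (hh t hlt j).1 i

/-- Completeness of the Hilbert system. -/
theorem HilbertDerivable.of_valid (p₀ : Var) (φ : MFormula Var)
    (hφ : KAValid.{u, v} φ.toFormula) : HilbertDerivable p₀ φ := by
  obtain ⟨k, β, -, hβ⟩ := (finite_boxBodies φ).fin_param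
  obtain h0 | ⟨h, h0, hh⟩ := nonneg_or_exists_tree (fun i => mk p₀ (β i)) (depth φ) (mk p₀ φ)
  · exact zero_le_mk.1 h0
  exfalso
  have hfin : (vars φ ×ˢ {t : List (Fin k) | t.length ≤ depth φ}).Finite :=
    (finite_vars φ).prod (List.finite_length_le _ _)
  obtain ⟨r, hr⟩ := (hfin.image fun z => |(h z.2 (mk p₀ (.var z.1)) : ℝ)|).bddAbove
  have hU : ∀ p ∈ vars φ, ∀ t : List (Fin k), t.length ≤ depth φ →
      |(h t (mk p₀ (.var p)) : ℝ)| ≤ max r 0 := fun p hp t ht =>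
    (hr (Set.mem_image_of_mem _ (Set.mk_mem_prod hp ht : (p, t) ∈ _))).trans (le_max_left _ _)
  have h1 := treeModel_value_eq.{u, v} (le_max_right r 0) β h (vars φ) (depth φ) hU hh φ
    subset_rfl hβ.ge [] (by simp)
  have h2 := hφ (treeModel k (max r 0) (le_max_right r 0) fun p t => (h t (mk p₀ (.var p)) : ℝ))
    ⟨[]⟩
  rw [h1] at h2
  exact absurd (by exact_mod_cast h2) (not_le.2 h0)

end Completeness

/-! ### The Hilbert system in the sequent calculus -/

section Sequent

variable {Var : Type u} {p₀ : Var}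

namespace SequentDerivable

variable {Γ Δ Θ Ξ : Multiset (MFormula Var)} {φ ψ : MFormula Var}

theorem of_eq (h : SequentDerivable Γ Δ) (h₁ : Γ = Θ) (h₂ : Δ = Ξ) : SequentDerivable Θ Ξ :=
  h₁ ▸ h₂ ▸ h

theorem imp_modus_ponens (φ ψ : MFormula Var) : SequentDerivable ({φ} + {imp φ ψ}) {ψ} :=
  impLeft _ _ _ _ (SequentDerivable.id _)

/-- The rule `⇒ →` is invertible. -/
theorem impRight_inv (h : SequentDerivable Γ ({imp φ ψ} + Δ)) :
    SequentDerivable (Γ + {φ}) ({ψ} + Δ) :=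
  (cut _ _ _ _ _ (imp_modus_ponens φ ψ) h).of_eq (add_comm _ _) (add_comm _ _)

theorem add_zero_left (h : SequentDerivable Γ Δ) : SequentDerivable (Γ + {zero p₀}) Δ :=
  impLeft _ _ _ _ ((mix _ _ _ _ h (SequentDerivable.id {var p₀})))

/-- `n φ` on the left of a sequent unfolds to `n` copies of `φ`. -/
theorem mult_left (n : ℕ) (φ : MFormula Var) :
    SequentDerivable {mult p₀ n φ} (n • {φ}) := by
  induction n with
  | zero => exact (add_zero_left (SequentDerivable.id 0)).of_eq (zero_add _) (zero_smul _ _).symm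
  | succ n ih =>
    have h : SequentDerivable {mult p₀ n φ} ({neg p₀ φ} + (n + 1) • {φ}) := by
      refine impRight _ _ _ _ ?_
      refine (mix _ _ _ _ (mix _ _ _ _ ih (SequentDerivable.id {φ}))
        (impRight 0 0 (var p₀) (var p₀) (SequentDerivable.id _))).of_eq (by simp) ?_
      rw [succ_nsmul, add_zero, add_comm (n • _)]
      rfl
    exact (impLeft 0 _ _ _ (h.of_eq (zero_add _).symm rfl)).of_eq (zero_add _) rfl

/-- `n` copies of `φ` on the right of a sequent may be collected to `n φ`. -/
theorem mult_right (n : ℕ) (h : SequentDerivable Γ (n • {φ} + Δ)) :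
    SequentDerivable Γ ({mult p₀ n φ} + Δ) := by
  induction n generalizing Γ Δ with
  | zero =>
    refine impRight _ _ _ _ ?_
    exact (mix _ _ _ _ h (SequentDerivable.id {var p₀})).of_eq rfl (by simp)
  | succ n ih =>
    refine impRight _ _ _ _ (ih (impLeft _ _ _ _ (add_zero_left ?_)))
    exact h.of_eq rfl (by rw [succ_nsmul', add_assoc])

theorem of_imp (h : SequentDerivable 0 {imp φ ψ}) : SequentDerivable {φ} {ψ} :=
  (impRight_inv (h.of_eq rfl (add_zero _).symm)).of_eq (zero_add _) (add_zero _)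

theorem imp_intro (h : SequentDerivable (Γ + {φ}) {ψ}) : SequentDerivable Γ {imp φ ψ} :=
  impRight Γ 0 φ ψ h

theorem of_hilbertDerivable (h : HilbertDerivable p₀ φ) : SequentDerivable 0 {φ} := by
  induction h with
  | axB φ ψ χ =>
    refine imp_intro (imp_intro (imp_intro ?_))
    have h := cut _ _ _ _ _ (imp_modus_ponens ψ χ |>.of_eq (add_comm _ _) rfl)
      (imp_modus_ponens φ ψ |>.of_eq rfl (add_zero _).symm)
    exact h.of_eq (by abel) (zero_add _)
  | axC φ ψ χ =>
    refine imp_intro (imp_intro (imp_intro ?_))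
    have h := cut _ _ _ _ _ (imp_modus_ponens ψ χ)
      (imp_modus_ponens φ (imp ψ χ) |>.of_eq rfl (add_zero _).symm)
    exact h.of_eq (by abel) (zero_add _)
  | axI φ => exact imp_intro ((SequentDerivable.id _).of_eq (zero_add _).symm rfl)
  | axA φ ψ =>
    refine imp_intro (impLeft _ _ _ _ (impRight _ _ _ _ ?_))
    exact (SequentDerivable.id ({ψ} + {φ})).of_eq (by abel) rfl
  | axK φ ψ =>
    refine imp_intro (imp_intro ?_)
    exact (boxRule 1 _ ψ ((imp_modus_ponens φ ψ).of_eq rfl (one_nsmul _).symm)).of_eq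
      (by rw [Multiset.map_add, add_comm]; rfl) (one_nsmul _)
  | axD n hn φ =>
    refine imp_intro (((mult_right (Δ := 0) n ?_).of_eq rfl (add_zero _)))
    exact (boxRule n _ φ (mult_left (p₀ := p₀) n φ)).of_eq (by simp) (by simp)
  | mp φ ψ _ _ ih₁ ih₂ =>
    exact (cut 0 _ 0 0 φ ((of_imp ih₂).of_eq (zero_add _).symm rfl)
      (ih₁.of_eq rfl (add_zero _).symm)).of_eq (zero_add _) (zero_add _)
  | nec φ _ ih =>
    exact (boxRule 1 _ φ (ih.of_eq rfl (one_nsmul _).symm)).of_eq (by simp) (one_nsmul _)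
  | con n hn φ _ ih =>
    refine sc n hn _ _ ?_
    exact (cut 0 _ 0 0 _ ((mult_left n φ).of_eq (zero_add _).symm rfl)
      (ih.of_eq rfl (add_zero _).symm)).of_eq (by simp) (zero_add _)

end SequentDerivable

/-! ### Soundness of the sequent calculus -/

theorem sum_value_box_le (M : KAModel.{u, v} Var) {x y : M.World} (hxy : M.R x y)
    (Γ : Multiset (MFormula Var)) :
    ((Γ.map box).map fun φ => M.value φ.toFormula x).sum ≤
      (Γ.map fun φ => M.value φ.toFormula y).sum := by
  rw [Multiset.map_map]
  exact Multiset.sum_map_le_sum_map _ _ fun φ _ =>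
    csInf_le (M.bddBelow_value φ.toFormula x) ⟨y, hxy, rfl⟩

theorem SequentDerivable.sum_value_le {Γ Δ : Multiset (MFormula Var)}
    (h : SequentDerivable Γ Δ) (M : KAModel.{u, v} Var) (x : M.World) :
    (Γ.map fun φ => M.value φ.toFormula x).sum ≤
      (Δ.map fun φ => M.value φ.toFormula x).sum := by
  induction h generalizing x with
  | id Δ => exact le_rfl
  | cut Γ Δ Θ Ξ φ _ _ ih₁ ih₂ =>
    have h₁ := ih₁ x
    have h₂ := ih₂ x
    simp only [Multiset.map_add, Multiset.sum_add, Multiset.map_singleton,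
      Multiset.sum_singleton] at h₁ h₂ ⊢
    linarith
  | mix Γ Δ Θ Ξ _ _ ih₁ ih₂ =>
    have h₁ := ih₁ x
    have h₂ := ih₂ x
    simp only [Multiset.map_add, Multiset.sum_add] at h₁ h₂ ⊢
    linarith
  | sc n hn Γ Δ _ ih =>
    have h := ih x
    simp only [Multiset.map_nsmul, Multiset.sum_nsmul, nsmul_eq_mul] at h
    exact le_of_mul_le_mul_left h (by positivity)
  | impLeft Γ Δ φ ψ _ ih =>
    have h := ih x
    simp only [Multiset.map_add, Multiset.sum_add, Multiset.map_singleton,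
      Multiset.sum_singleton, toFormula, KAModel.value] at h ⊢
    linarith
  | impRight Γ Δ φ ψ _ ih =>
    have h := ih x
    simp only [Multiset.map_add, Multiset.sum_add, Multiset.map_singleton,
      Multiset.sum_singleton, toFormula, KAModel.value] at h ⊢
    linarith
  | boxRule n Γ φ _ ih =>
    simp only [Multiset.map_nsmul, Multiset.sum_nsmul, nsmul_eq_mul, Multiset.map_singleton,
      Multiset.sum_singleton] at ih ⊢
    by_cases hx : ∃ y, M.R x y
    · obtain ⟨y₀, hy₀⟩ := hx
      obtain rfl | hn := Nat.eq_zero_or_pos n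
      · simpa using (sum_value_box_le M hy₀ Γ).trans (ih y₀)
      · have hn' : (0 : ℝ) < n := by exact_mod_cast hn
        rw [← div_le_iff₀' hn']
        refine le_csInf ⟨_, y₀, hy₀, rfl⟩ ?_
        rintro _ ⟨y, hy, rfl⟩
        rw [div_le_iff₀' hn']
        exact (sum_value_box_le M hy Γ).trans (ih y)
    · -- At a world without successors every boxed formula has the value `sInf ∅ = 0`.
      have h0 : ∀ ψ : MFormula Var, M.value (box ψ).toFormula x = 0 := fun ψ => by
        have : {a : ℝ | ∃ y, M.R x y ∧ a = M.value ψ.toFormula y} = ∅ := by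
          rw [Set.eq_empty_iff_forall_notMem]
          rintro _ ⟨y, hy, -⟩
          exact hx ⟨y, hy⟩
        simp only [toFormula, KAModel.value, this, Real.sInf_empty]
      simp [Multiset.map_map, h0]

theorem SequentDerivable.valid {φ : MFormula Var} (h : SequentDerivable 0 {φ}) :
    KAValid.{u, v} φ.toFormula := fun M x => by
  simpa using h.sum_value_le M x

end Sequent

end ModalAbelian

theorem mainTheorem1 {Var : Type u} [Countable Var] [Infinite Var] (p₀ : Var)
    (φ : ModalAbelian.MFormula Var) :
    List.TFAE [ModalAbelian.KAValid.{u, v} φ.toFormula,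
      ModalAbelian.HilbertDerivable p₀ φ,
      ModalAbelian.SequentDerivable 0 {φ}] := by
  tfae_have 1 → 2 := ModalAbelian.HilbertDerivable.of_valid p₀ φ
  tfae_have 2 → 3 := ModalAbelian.SequentDerivable.of_hilbertDerivable
  tfae_have 3 → 1 := ModalAbelian.SequentDerivable.valid
  tfae_finish
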